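/- Consider the set $\mathbb{Z}[x]$ of integer polynomials with the operations of addition and composition, $(f\circ g)(x)=f(g(x))$; these make it a nearring. The subnearring generated by a set $F\subseteq\mathbb{Z}[x]$ is the smallest subset of $\mathbb{Z}[x]$ that contains $F$ and $0$ and is closed under addition, negation and composition. For $i\in\mathbb{N}_0$ let $s_3(i)$ denote the sum of the base-$3$ digits of $i$ (this is odd when $i$ is odd). Then a polynomial $p=\sum_{i=0}^n c_i x^i\in\mathbb{Z}[x]$ (with $c_i=0$ for $i>n$) lies in the subnearring generated by $\{x,x^3\}$ if and only if all of the following conditions hold: 1. $c_i=0$ for every even $i\in\mathbb{N}_0$; 2. $3^{(s_3(i)-1)/2}$ divides $c_i$ for every odd $i\in\mathbb{N}_0$; 3. $2$ divides $\sum_{j} c_j$, where $j$ runs over all $j\in\mathbb{N}_0$ with $j\equiv 5$ or $7\pmod 8$; 4. $2$ divides $\sum_{j} c_j$, where $j$ runs over all $j\in\mathbb{N}_0$ with $j\neq 1$ and $j$ congruent to one of $1,11,15,17,19,21$ modulo $24$. -/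

import Mathlib

open Polynomial

/-- A subnearring of the nearring `(ℤ[X], +, ∘)` of integer polynomials under addition and
composition: a subset containing `0` and closed under `+`, `-` and composition. -/
structure PolySubnearring extends AddSubgroup ℤ[X] where
  comp_mem' : ∀ {f g : ℤ[X]}, f ∈ carrier → g ∈ carrier → f.comp g ∈ carrier

/-- The subnearring of `(ℤ[X], +, ∘)` generated by `F`: the intersection of all subnearrings
that contain `F`. -/
def PolySubnearring.closure (F : Set ℤ[X]) : PolySubnearring where
  carrier := {p | ∀ S : PolySubnearring, F ⊆ S.carrier → p ∈ S.carrier}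
  add_mem' := fun hp hq S hS => S.add_mem' (hp S hS) (hq S hS)
  zero_mem' := fun S _ => S.zero_mem'
  neg_mem' := fun hp S hS => S.neg_mem' (hp S hS)
  comp_mem' := fun hp hq S hS => S.comp_mem' (hp S hS) (hq S hS)

/-- The set of natural numbers congruent modulo `m` to one of the numbers in `Y`. -/
def eqClass (m : ℕ) (Y : Finset ℕ) : Set ℕ := {x | ∃ y ∈ Y, x ≡ y [MOD m]}

instance eqClass.decidableMem (m : ℕ) (Y : Finset ℕ) (x : ℕ) : Decidable (x ∈ eqClass m Y) :=
  inferInstanceAs (Decidable (∃ y ∈ Y, x ≡ y [MOD m]))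

/-- The sum of the digits of `a` in base `b`. -/
def digitSum (b a : ℕ) : ℕ := (Nat.digits b a).sum

/-! ### Base-3 digit sums -/

/-! The generated subnearring is the smallest additive subgroup of `ℤ[X]` that contains `X` and is
closed under cubing, so it is compared with the group `admissible` cut out by the four conditions.

Conditions are preserved by cubing: cross terms carry a factor 3, which pays for the exponents
because the base-3 digit sum is subadditive and `s₃(3i) = s₃(i)`. Modulo 2, both parities of `f ^ 3`
equal the first parity of `f` times `f(1)` (`parity_pow_three`).

Conversely, let `G ≤ admissible` contain `X` and be closed under cubing. Induction on the degree `n`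
shows that `G` is everything. Polarizing the cube puts `6fgh` in `G`, hence a power of 2 times the
required modulus times `X ^ n`. So an element of `G` of degree `n` with odd leading coefficient
suffices. For `n = a + 2j` with `a ∈ {1, 3}` it is `3(f²g + fg²)`, with `f = X ^ a` and `g`
admissible of degree `j`. This fails when `j` is 5 or 11, where the parities force even leading
coefficients, or when `n` is small; those degrees are treated by hand. -/

theorem digitSum_three_mul_add (a r : ℕ) (hr : r < 3) :
    digitSum 3 (3 * a + r) = digitSum 3 a + r := by
  unfold digitSum
  rcases Nat.eq_zero_or_pos (3 * a + r) with h | h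
  · obtain ⟨rfl, rfl⟩ : a = 0 ∧ r = 0 := by omega
    simp
  · rw [Nat.digits_def' (by norm_num) h, List.sum_cons,
      show (3 * a + r) % 3 = r by omega, show (3 * a + r) / 3 = a by omega, add_comm]

theorem digitSum_three_mul (a : ℕ) : digitSum 3 (3 * a) = digitSum 3 a := by
  simpa using digitSum_three_mul_add a 0 (by norm_num)

/-- Legendre's formula `2 v₃(n!) = n - s₃(n)` turns the divisibility of `(a + b)!` by `a! b!` into
this inequality. -/
theorem digitSum_add_le (a b : ℕ) : digitSum 3 (a + b) ≤ digitSum 3 a + digitSum 3 b := by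
  have h := fun n => sub_one_mul_padicValNat_factorial (p := 3) n
  have hle := fun n => Nat.digit_sum_le 3 n
  have hv : padicValNat 3 (a.factorial * b.factorial) ≤ padicValNat 3 (a + b).factorial :=
    (padicValNat_dvd_iff_le (Nat.factorial_ne_zero _)).1
      (pow_padicValNat_dvd.trans (Nat.factorial_mul_factorial_dvd_factorial_add a b))
  rw [padicValNat.mul (Nat.factorial_ne_zero _) (Nat.factorial_ne_zero _)] at hv
  have := h a; have := h b; have := h (a + b)
  have := hle a; have := hle b; have := hle (a + b)
  unfold digitSum
  omega

theorem digitSum_mod_two (a : ℕ) : digitSum 3 a % 2 = a % 2 :=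
  (Nat.modEq_digits_sum 2 3 (by norm_num) a).symm

/-- The lowest nonzero base-3 digit, at place `a`, is lowered by one. -/
theorem exists_eq_three_pow_add {i : ℕ} (hi : i ≠ 0) :
    ∃ a c, i = 3 ^ a + c ∧ digitSum 3 i = digitSum 3 c + 1 := by
  induction i using Nat.strong_induction_on with
  | _ i ih =>
    by_cases h : i % 3 = 0
    · obtain ⟨a, c, h1, h2⟩ := ih (i / 3) (by omega) (by omega)
      refine ⟨a + 1, 3 * c, by rw [pow_succ]; omega, ?_⟩
      rw [digitSum_three_mul, ← h2, ← digitSum_three_mul (i / 3), show 3 * (i / 3) = i by omega]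
    · refine ⟨0, i - 1, by rw [pow_zero]; omega, ?_⟩
      have h1 := digitSum_three_mul_add (i / 3) (i % 3) (by omega)
      have h2 := digitSum_three_mul_add (i / 3) (i % 3 - 1) (by omega)
      rw [show 3 * (i / 3) + i % 3 = i by omega] at h1
      rw [show 3 * (i / 3) + (i % 3 - 1) = i - 1 by omega] at h2
      omega

/-! ### Divisibility of the coefficients -/

/-- The modulus required of the coefficient of `X ^ i`; it vanishes for even `i`. -/
def coeffModulus (i : ℕ) : ℤ := if Odd i then 3 ^ ((digitSum 3 i - 1) / 2) else 0

theorem coeffModulus_of_odd {i : ℕ} (hi : Odd i) :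
    coeffModulus i = 3 ^ ((digitSum 3 i - 1) / 2) := if_pos hi

theorem coeffModulus_of_even {i : ℕ} (hi : Even i) : coeffModulus i = 0 :=
  if_neg (Nat.not_odd_iff_even.2 hi)

theorem odd_coeffModulus {i : ℕ} (hi : Odd i) : Odd (coeffModulus i) := by
  rw [coeffModulus_of_odd hi]; exact Odd.pow (by decide)

/-- For odd indices the exponents on the right, with the extra 3, add up to `(s₃(i) + s₃(j) + s₃(k)
- 1) / 2`, and the digit sum is subadditive. An even index makes the right side 0. -/
theorem coeffModulus_add_add_dvd (i j k : ℕ) :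
    coeffModulus (i + j + k) ∣ 3 * (coeffModulus i * coeffModulus j * coeffModulus k) := by
  by_cases hi : Odd i; swap
  · simp [coeffModulus, hi]
  by_cases hj : Odd j; swap
  · simp [coeffModulus, hj]
  by_cases hk : Odd k; swap
  · simp [coeffModulus, hk]
  rw [coeffModulus_of_odd hi, coeffModulus_of_odd hj, coeffModulus_of_odd hk,
    coeffModulus_of_odd ((hi.add_odd hj).add_odd hk), ← pow_add, ← pow_add, ← pow_succ']
  apply pow_dvd_pow
  have h1 := digitSum_add_le (i + j) k
  have h2 := digitSum_add_le i j
  have := digitSum_mod_two i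
  have := digitSum_mod_two j
  have := digitSum_mod_two k
  rw [Nat.odd_iff] at hi hj hk
  omega

theorem coeffModulus_three_mul (i : ℕ) : coeffModulus (3 * i) = coeffModulus i := by
  simp [coeffModulus, Nat.odd_mul, digitSum_three_mul, show Odd 3 by decide]

/-- The polynomials whose coefficients satisfy the divisibility conditions. -/
def divisibleCoeffs : AddSubgroup ℤ[X] where
  carrier := {p | ∀ i, coeffModulus i ∣ p.coeff i}
  add_mem' hp hq i := by rw [coeff_add]; exact dvd_add (hp i) (hq i)
  zero_mem' i := by simp
  neg_mem' hp i := by rw [coeff_neg]; exact (dvd_neg).2 (hp i)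

theorem monomial_mem_divisibleCoeffs {i : ℕ} {c : ℤ} (h : coeffModulus i ∣ c) :
    monomial i c ∈ divisibleCoeffs := by
  intro j
  rw [coeff_monomial]
  split_ifs with hij
  · exact hij ▸ h
  · exact dvd_zero _

theorem divisibleCoeffs_induction {P : ℤ[X] → Prop} (zero : P 0)
    (add : ∀ p ∈ divisibleCoeffs, ∀ q ∈ divisibleCoeffs, P p → P q → P (p + q))
    (mono : ∀ i c, coeffModulus i ∣ c → P (monomial i c))
    {p : ℤ[X]} (hp : p ∈ divisibleCoeffs) : P p := by
  rw [p.as_sum_support]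
  refine (Finset.sum_induction (p := fun q => q ∈ divisibleCoeffs ∧ P q) _
    (fun a b ha hb => ⟨add_mem ha.1 hb.1, add a ha.1 b hb.1 ha.2 hb.2⟩)
    ⟨zero_mem _, zero⟩ fun i _ => ⟨monomial_mem_divisibleCoeffs (hp i), mono i _ (hp i)⟩).2

theorem three_mul_mul_mul_mem_divisibleCoeffs {f g h : ℤ[X]} (hf : f ∈ divisibleCoeffs)
    (hg : g ∈ divisibleCoeffs) (hh : h ∈ divisibleCoeffs) :
    3 * (f * g * h) ∈ divisibleCoeffs := by
  intro n
  rw [show (3 : ℤ[X]) = C 3 by simp, coeff_C_mul, coeff_mul, Finset.mul_sum]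
  refine Finset.dvd_sum fun x hx => ?_
  rw [coeff_mul, Finset.sum_mul, Finset.mul_sum]
  refine Finset.dvd_sum fun y hy => ?_
  rw [← Finset.HasAntidiagonal.mem_antidiagonal.1 hx, ← Finset.HasAntidiagonal.mem_antidiagonal.1 hy]
  exact (coeffModulus_add_add_dvd _ _ _).trans
    (mul_dvd_mul_left _ (mul_dvd_mul (mul_dvd_mul (hf _) (hg _)) (hh _)))

theorem pow_three_mem_divisibleCoeffs {f : ℤ[X]} (hf : f ∈ divisibleCoeffs) :
    f ^ 3 ∈ divisibleCoeffs := by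
  refine divisibleCoeffs_induction (P := fun f => f ^ 3 ∈ divisibleCoeffs) ?_ ?_ ?_ hf
  · simp
  · intro p hp q hq h1 h2
    rw [show (p + q) ^ 3 = p ^ 3 + q ^ 3 + 3 * (p * p * q) + 3 * (p * q * q) by ring]
    exact add_mem (add_mem (add_mem h1 h2) (three_mul_mul_mul_mem_divisibleCoeffs hp hp hq))
      (three_mul_mul_mul_mem_divisibleCoeffs hp hq hq)
  · intro i c hc
    rw [monomial_pow, mul_comm]
    apply monomial_mem_divisibleCoeffs
    rw [coeffModulus_three_mul]
    exact hc.trans (dvd_pow_self _ (by norm_num))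

/-! ### Parity functionals -/

/-- The reduction modulo `2` of `∑ χ j * p.coeff j`. -/
def parity (χ : ℕ → ZMod 2) : ℤ[X] →+ ZMod 2 where
  toFun p := p.sum fun j c => χ j * c
  map_zero' := by simp
  map_add' p q := by
    apply sum_add_index
    · simp
    · intro i a b; push_cast; ring

theorem parity_monomial (χ : ℕ → ZMod 2) (i : ℕ) (c : ℤ) :
    parity χ (monomial i c) = χ i * c :=
  sum_monomial_index c (fun j (c : ℤ) => χ j * (c : ZMod 2)) (by simp)

theorem parity_eq_sum_range (χ : ℕ → ZMod 2) {p : ℤ[X]} {n : ℕ} (hp : ∀ m ≥ n, p.coeff m = 0) :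
    parity χ p = ∑ j ∈ Finset.range n, χ j * p.coeff j := by
  refine Finset.sum_subset (fun i hi => ?_) fun i _ hi => ?_
  · by_contra h
    exact mem_support_iff.1 hi (hp i (by simpa using h))
  · rw [notMem_support_iff.1 hi]; simp

theorem parity_two_mul (χ : ℕ → ZMod 2) (p : ℤ[X]) : parity χ (2 * p) = 0 := by
  rw [two_mul, map_add, CharTwo.add_self_eq_zero]

theorem two_dvd_sum_filter_iff (p : ℤ[X]) (P : ℕ → Prop) [DecidablePred P] :
    (2 : ℤ) ∣ ∑ j ∈ p.support with P j, p.coeff j ↔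
      parity (fun j => if P j then 1 else 0) p = 0 := by
  rw [show parity (fun j => if P j then 1 else 0) p =
    ((∑ j ∈ p.support with P j, p.coeff j : ℤ) : ZMod 2) by
      simp [parity, Polynomial.sum, Finset.sum_filter, ite_mul]]
  exact (ZMod.intCast_zmod_eq_zero_iff_dvd _ 2).symm

theorem odd_of_coeffModulus_dvd {i : ℕ} {c : ℤ} (h : coeffModulus i ∣ c) : Odd i ∨ c = 0 := by
  by_cases hi : Odd i
  · exact Or.inl hi
  · exact Or.inr (by simpa [coeffModulus, hi] using h)

/-- The indicator function of the residue classes `5` and `7` modulo `8`. -/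
def indicatorEight (j : ℕ) : ZMod 2 := if j ∈ eqClass 8 {5, 7} then 1 else 0

/-- The indicator function of the residue classes `1, 11, 15, 17, 19, 21` modulo `24`, with the
number `1` left out. -/
def indicatorTwentyFour (j : ℕ) : ZMod 2 :=
  if j ∈ eqClass 24 {1, 11, 15, 17, 19, 21} ∧ j ≠ 1 then 1 else 0

theorem ZMod.two_mul_self_eq (a : ZMod 2) : a * a = a := by revert a; decide

/-- Modulo 2 the form `f²g + fg²` is biadditive, because its cross terms are doubled. The identity
therefore reduces to monomials, where it is the hypothesis on `χ` and `ψ`. -/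
theorem parity_polarized {χ ψ : ℕ → ZMod 2}
    (h : ∀ i j, Odd i → Odd j → χ (2 * i + j) + χ (i + 2 * j) = ψ i + ψ j)
    {f g : ℤ[X]} (hf : f ∈ divisibleCoeffs) (hg : g ∈ divisibleCoeffs) :
    parity χ (f ^ 2 * g + f * g ^ 2) =
      parity ψ f * (g.eval 1 : ℤ) + parity ψ g * (f.eval 1 : ℤ) := by
  refine divisibleCoeffs_induction (P := fun f => parity χ (f ^ 2 * g + f * g ^ 2) =
      parity ψ f * (g.eval 1 : ℤ) + parity ψ g * (f.eval 1 : ℤ)) ?_ ?_ ?_ hf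
  · simp
  · intro p _ q _ hp hq
    rw [show (p + q) ^ 2 * g + (p + q) * g ^ 2 =
      (p ^ 2 * g + p * g ^ 2) + (q ^ 2 * g + q * g ^ 2) + 2 * (p * q * g) by ring,
      map_add, map_add, parity_two_mul, hp, hq, map_add, eval_add]
    push_cast; ring
  intro i c hc
  refine divisibleCoeffs_induction (P := fun g =>
    parity χ (monomial i c ^ 2 * g + monomial i c * g ^ 2) =
      parity ψ (monomial i c) * (g.eval 1 : ℤ) + parity ψ g * ((monomial i c).eval 1 : ℤ))
      ?_ ?_ ?_ hg
  · simp
  · intro p _ q _ hp hq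
    rw [show monomial i c ^ 2 * (p + q) + monomial i c * (p + q) ^ 2 =
      (monomial i c ^ 2 * p + monomial i c * p ^ 2) +
      (monomial i c ^ 2 * q + monomial i c * q ^ 2) + 2 * (monomial i c * p * q) by ring,
      map_add, map_add, parity_two_mul, hp, hq, map_add, eval_add]
    push_cast; ring
  intro j d hd
  rcases odd_of_coeffModulus_dvd hc with hi | rfl; swap
  · simp
  rcases odd_of_coeffModulus_dvd hd with hj | rfl; swap
  · simp
  have key := h i j hi hj
  simp only [monomial_pow, monomial_mul_monomial, map_add, parity_monomial, eval_monomial,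
    one_pow, mul_one]
  rw [mul_comm i 2, mul_comm j 2]
  push_cast
  simp only [pow_two, ZMod.two_mul_self_eq]
  linear_combination (c * d : ZMod 2) * key

theorem parity_pow_three {χ ψ : ℕ → ZMod 2}
    (h : ∀ i j, Odd i → Odd j → χ (2 * i + j) + χ (i + 2 * j) = ψ i + ψ j)
    (h' : ∀ i, Odd i → χ (3 * i) = ψ i) {f : ℤ[X]} (hf : f ∈ divisibleCoeffs) :
    parity χ (f ^ 3) = parity ψ f * (f.eval 1 : ℤ) := by
  refine divisibleCoeffs_induction (P := fun f =>
    parity χ (f ^ 3) = parity ψ f * (f.eval 1 : ℤ)) ?_ ?_ ?_ hf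
  · simp
  · intro p hp q hq h1 h2
    rw [show (p + q) ^ 3 = p ^ 3 + q ^ 3 + (p ^ 2 * q + p * q ^ 2) +
      2 * (p ^ 2 * q + p * q ^ 2) by ring, map_add, map_add, map_add, parity_two_mul, h1, h2,
      parity_polarized h hp hq, map_add, eval_add]
    push_cast; ring
  · intro i c hc
    rcases odd_of_coeffModulus_dvd hc with hi | rfl; swap
    · simp
    simp only [monomial_pow, parity_monomial, eval_monomial, one_pow, mul_one]
    rw [mul_comm i 3, h' i hi]
    push_cast
    simp only [pow_succ, pow_zero, one_mul, ZMod.two_mul_self_eq, mul_assoc]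

/-! ### Congruence identities of the two indicators -/

theorem indicatorEight_eq (j : ℕ) :
    indicatorEight j = if j % 8 = 5 ∨ j % 8 = 7 then 1 else 0 := by
  simp [indicatorEight, eqClass, Nat.ModEq]

theorem indicatorTwentyFour_eq (j : ℕ) :
    indicatorTwentyFour j = if (j % 24 = 1 ∨ j % 24 = 11 ∨ j % 24 = 15 ∨ j % 24 = 17 ∨
      j % 24 = 19 ∨ j % 24 = 21) ∧ j ≠ 1 then 1 else 0 := by
  simp [indicatorTwentyFour, eqClass, Nat.ModEq]

theorem indicatorEight_polar (i j : ℕ) (hi : Odd i) (hj : Odd j) :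
    indicatorEight (2 * i + j) + indicatorEight (i + 2 * j) =
      indicatorEight i + indicatorEight j := by
  have key : ∀ a < 8, ∀ b < 8, a % 2 = 1 → b % 2 = 1 →
      indicatorEight (2 * a + b) + indicatorEight (a + 2 * b) =
      indicatorEight a + indicatorEight b := by
    simp only [indicatorEight_eq]; decide
  have hmod : ∀ x y, x % 8 = y % 8 → indicatorEight x = indicatorEight y := by
    intro x y h; rw [indicatorEight_eq, indicatorEight_eq, h]
  rw [Nat.odd_iff] at hi hj
  rw [hmod (2 * i + j) (2 * (i % 8) + j % 8) (by omega),
    hmod (i + 2 * j) (i % 8 + 2 * (j % 8)) (by omega), hmod i (i % 8) (by omega),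
    hmod j (j % 8) (by omega)]
  exact key _ (by omega) _ (by omega) (by omega) (by omega)

theorem indicatorEight_three_mul (i : ℕ) (hi : Odd i) :
    indicatorEight (3 * i) = indicatorEight i := by
  rw [Nat.odd_iff] at hi
  rw [indicatorEight_eq, indicatorEight_eq]
  congr 1
  simp only [eq_iff_iff]
  omega

theorem indicatorTwentyFour_polar (i j : ℕ) (hi : Odd i) (hj : Odd j) :
    indicatorTwentyFour (2 * i + j) + indicatorTwentyFour (i + 2 * j) =
      indicatorEight i + indicatorEight j := by
  have key : ∀ a < 24, ∀ b < 24, a % 2 = 1 → b % 2 = 1 →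
      indicatorTwentyFour (24 + 2 * a + b) + indicatorTwentyFour (24 + a + 2 * b) =
      indicatorEight a + indicatorEight b := by
    simp only [indicatorEight_eq, indicatorTwentyFour_eq]; decide
  have hmod : ∀ x y, x % 24 = y % 24 → indicatorEight x = indicatorEight y := by
    intro x y h
    rw [indicatorEight_eq, indicatorEight_eq, show x % 8 = y % 8 by omega]
  -- The omitted index 1 does no harm: `2i + j` and `i + 2j` are at least 3 for odd `i`, `j`.
  have hmod' : ∀ x y, x % 24 = y % 24 → x ≠ 1 → y ≠ 1 →
      indicatorTwentyFour x = indicatorTwentyFour y := by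
    intro x y h hx hy
    rw [indicatorTwentyFour_eq, indicatorTwentyFour_eq, h]
    simp [hx, hy]
  rw [Nat.odd_iff] at hi hj
  rw [hmod' (2 * i + j) (24 + 2 * (i % 24) + j % 24) (by omega) (by omega) (by omega),
    hmod' (i + 2 * j) (24 + i % 24 + 2 * (j % 24)) (by omega) (by omega) (by omega),
    hmod i (i % 24) (by omega), hmod j (j % 24) (by omega)]
  exact key _ (by omega) _ (by omega) (by omega) (by omega)

theorem indicatorTwentyFour_three_mul (i : ℕ) (hi : Odd i) :
    indicatorTwentyFour (3 * i) = indicatorEight i := by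
  rw [Nat.odd_iff] at hi
  rw [indicatorEight_eq, indicatorTwentyFour_eq]
  congr 1
  simp only [eq_iff_iff]
  omega

/-- The polynomials that satisfy the divisibility and the parity conditions. -/
noncomputable def admissible : AddSubgroup ℤ[X] :=
  divisibleCoeffs ⊓ ((parity indicatorEight).ker ⊓ (parity indicatorTwentyFour).ker)

theorem mem_admissible {p : ℤ[X]} : p ∈ admissible ↔ p ∈ divisibleCoeffs ∧
    parity indicatorEight p = 0 ∧ parity indicatorTwentyFour p = 0 := Iff.rfl

theorem pow_three_mem_admissible {f : ℤ[X]} (hf : f ∈ admissible) : f ^ 3 ∈ admissible := by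
  rw [mem_admissible] at hf ⊢
  refine ⟨pow_three_mem_divisibleCoeffs hf.1, ?_, ?_⟩
  · rw [parity_pow_three indicatorEight_polar indicatorEight_three_mul hf.1, hf.2.1, zero_mul]
  · rw [parity_pow_three indicatorTwentyFour_polar indicatorTwentyFour_three_mul hf.1, hf.2.1,
      zero_mul]

theorem digitSum_one : digitSum 3 1 = 1 := by simp [digitSum]

theorem X_mem_admissible : (X : ℤ[X]) ∈ admissible := by
  rw [← monomial_one_one_eq_X, mem_admissible]
  refine ⟨monomial_mem_divisibleCoeffs ?_, ?_, ?_⟩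
  · simp [coeffModulus, digitSum_one]
  · rw [parity_monomial, indicatorEight_eq]; simp
  · rw [parity_monomial, indicatorTwentyFour_eq]; simp

/-! ### Subgroups closed under cubing -/

theorem PolySubnearring.pow_three_mem_closure {f : ℤ[X]}
    (hf : f ∈ (closure {X, X ^ 3}).toAddSubgroup) :
    f ^ 3 ∈ (closure {X, X ^ 3}).toAddSubgroup := by
  have h : (X ^ 3 : ℤ[X]) ∈ (closure {X, X ^ 3}).carrier := fun S hS => hS (by simp)
  simpa using (closure {X, X ^ 3}).comp_mem' h hf

/-- The polynomials that map `G` into itself by left composition form a subnearring containing `X`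
and `X ^ 3`; applying such a polynomial to `X ∈ G` gives the claim. -/
theorem PolySubnearring.closure_le {G : AddSubgroup ℤ[X]} (hX : X ∈ G)
    (hG : ∀ f ∈ G, f ^ 3 ∈ G) : (closure {X, X ^ 3}).toAddSubgroup ≤ G := by
  let T : PolySubnearring :=
    { carrier := {f | ∀ g ∈ G, f.comp g ∈ G}
      add_mem' := fun hp hq g hg => by rw [add_comp]; exact add_mem (hp g hg) (hq g hg)
      zero_mem' := fun g _ => by rw [zero_comp]; exact zero_mem _
      neg_mem' := fun hp g hg => by rw [neg_comp]; exact neg_mem (hp g hg)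
      comp_mem' := fun hp hq g hg => by rw [comp_assoc]; exact hp _ (hq g hg) }
  intro f hf
  have hT : f ∈ T.carrier := by
    refine hf T ?_
    rintro p (rfl | rfl) g hg
    · simpa using hg
    · simpa using hG g hg
  simpa using hT X hX


theorem cubic_mem {G : AddSubgroup ℤ[X]} (hG : ∀ f ∈ G, f ^ 3 ∈ G) {f g : ℤ[X]}
    (hf : f ∈ G) (hg : g ∈ G) : 3 * (f ^ 2 * g + f * g ^ 2) ∈ G := by
  rw [show 3 * (f ^ 2 * g + f * g ^ 2) = (f + g) ^ 3 - f ^ 3 - g ^ 3 by ring]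
  exact sub_mem (sub_mem (hG _ (add_mem hf hg)) (hG _ hf)) (hG _ hg)

theorem six_mul_mem {G : AddSubgroup ℤ[X]} (hG : ∀ f ∈ G, f ^ 3 ∈ G) {f g h : ℤ[X]}
    (hf : f ∈ G) (hg : g ∈ G) (hh : h ∈ G) : 6 * (f * g * h) ∈ G := by
  rw [show 6 * (f * g * h) =
    3 * ((f + g) ^ 2 * h + (f + g) * h ^ 2) - 3 * (f ^ 2 * h + f * h ^ 2) -
      3 * (g ^ 2 * h + g * h ^ 2) by ring]
  exact sub_mem (sub_mem (cubic_mem hG (add_mem hf hg) hh) (cubic_mem hG hf hh))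
    (cubic_mem hG hg hh)

theorem X_pow_three_pow_mem {G : AddSubgroup ℤ[X]} (hX : X ∈ G) (hG : ∀ f ∈ G, f ^ 3 ∈ G)
    (a : ℕ) : X ^ 3 ^ a ∈ G := by
  induction a with
  | zero => simpa using hX
  | succ a ih => rw [pow_succ, pow_mul]; exact hG _ ih

/-- Splitting `i = 3 ^ a + 3 ^ b + d` lowers the digit sum by 2. In `6fgh` the factor 3 is the
matching growth of the modulus and the factor 2 goes into `2 ^ k`. -/
theorem exists_two_pow_mul_monomial_mem {G : AddSubgroup ℤ[X]} (hX : X ∈ G)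
    (hG : ∀ f ∈ G, f ^ 3 ∈ G) {i : ℕ} (hi : Odd i) :
    ∃ k : ℕ, monomial i (2 ^ k * coeffModulus i) ∈ G := by
  induction i using Nat.strong_induction_on with
  | _ i ih =>
    have h0 : digitSum 3 0 = 0 := by simp [digitSum]
    obtain ⟨a, c, rfl, hc⟩ := exists_eq_three_pow_add (i := i) (by rintro rfl; simp at hi)
    rcases eq_or_ne c 0 with rfl | hc0
    · refine ⟨0, ?_⟩
      rw [coeffModulus_of_odd hi, hc, h0]
      simpa [monomial_one_right_eq_X_pow] using X_pow_three_pow_mem hX hG a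
    obtain ⟨b, d, rfl, hd⟩ := exists_eq_three_pow_add hc0
    have hpa : Odd (3 ^ a) := Odd.pow (by decide)
    have hpb : Odd (3 ^ b) := Odd.pow (by decide)
    have hdo : Odd d := by
      rw [Nat.odd_iff] at *
      omega
    obtain ⟨k, hk⟩ := ih d (by have := hpa.pos; have := hpb.pos; omega) hdo
    refine ⟨k + 1, ?_⟩
    have := six_mul_mem hG (X_pow_three_pow_mem hX hG a) (X_pow_three_pow_mem hX hG b) hk
    convert this using 1
    have hs : (digitSum 3 (3 ^ a + (3 ^ b + d)) - 1) / 2 = (digitSum 3 d - 1) / 2 + 1 := by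
      have := digitSum_mod_two d
      rw [Nat.odd_iff] at hdo
      omega
    rw [coeffModulus_of_odd hi, coeffModulus_of_odd hdo, hs, ← C_mul_X_pow_eq_monomial,
      ← C_mul_X_pow_eq_monomial]
    simp only [map_mul, map_pow, map_ofNat]
    ring

/-! ### Induction on the degree -/

/-- The admissible polynomials of degree less than `n` lie in `G`. -/
def ContainsBelow (G : AddSubgroup ℤ[X]) (n : ℕ) : Prop :=
  ∀ q ∈ admissible, (∀ m ≥ n, q.coeff m = 0) → q ∈ G

theorem coeff_eq_zero_of_sub {q r : ℤ[X]} {n : ℕ} (hq : ∀ m ≥ n + 1, q.coeff m = 0)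
    (hr : ∀ m ≥ n + 1, r.coeff m = 0) (h : q.coeff n = r.coeff n) :
    ∀ m ≥ n, (q - r).coeff m = 0 := by
  intro m hm
  rw [coeff_sub]
  rcases hm.eq_or_lt with rfl | hm
  · rw [h, sub_self]
  · rw [hq m hm, hr m hm, sub_self]

theorem ContainsBelow.succ_of_forall_exists {G : AddSubgroup ℤ[X]} {n : ℕ}
    (hGM : G ≤ admissible) (h : ContainsBelow G n)
    (hex : ∀ q ∈ admissible, (∀ m ≥ n + 1, q.coeff m = 0) →
      ∃ r ∈ G, (∀ m ≥ n + 1, r.coeff m = 0) ∧ q.coeff n = r.coeff n) :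
    ContainsBelow G (n + 1) := by
  intro q hq hn
  obtain ⟨r, hr, hrn, hqr⟩ := hex q hq hn
  rw [← sub_add_cancel q r]
  exact add_mem (h _ (sub_mem hq (hGM hr)) (coeff_eq_zero_of_sub hn hrn hqr)) hr

theorem coeff_monomial_eq_zero_of_lt {i : ℕ} (c : ℤ) : ∀ m ≥ i + 1, (monomial i c).coeff m = 0 :=
  fun m hm => by rw [coeff_monomial, if_neg (by omega)]

/-- The leading coefficient of `p` is an odd multiple `s` of the modulus. As `s` is coprime to `2 ^
k`, a Bézout combination with the monomial above reaches every multiple. -/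
theorem ContainsBelow.succ_of_odd_coeff {G : AddSubgroup ℤ[X]} {n : ℕ} (hX : X ∈ G)
    (hG : ∀ f ∈ G, f ^ 3 ∈ G) (hGM : G ≤ admissible) (h : ContainsBelow G n) (hn : Odd n)
    {p : ℤ[X]} (hp : p ∈ G) (hpn : ∀ m ≥ n + 1, p.coeff m = 0) (hodd : Odd (p.coeff n)) :
    ContainsBelow G (n + 1) := by
  refine h.succ_of_forall_exists hGM fun q hq hqn => ?_
  obtain ⟨k, hk⟩ := exists_two_pow_mul_monomial_mem hX hG hn
  obtain ⟨s, hs⟩ := (hGM hp).1 n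
  obtain ⟨t, ht⟩ := hq.1 n
  have hs' : Odd s := by
    rw [hs] at hodd
    exact (Int.odd_mul.1 hodd).2
  obtain ⟨r, hr⟩ := hs'
  obtain ⟨u, v, huv⟩ : IsCoprime s (2 ^ k) :=
    IsCoprime.pow_right ⟨1, -r, by rw [hr]; ring⟩
  refine ⟨(t * u) • p + (t * v) • monomial n (2 ^ k * coeffModulus n),
    add_mem (zsmul_mem hp _) (zsmul_mem hk _), fun m hm => ?_, ?_⟩
  · rw [coeff_add, coeff_smul, coeff_smul, hpn m hm, coeff_monomial_eq_zero_of_lt _ m hm]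
    simp
  · rw [coeff_add, coeff_smul, coeff_smul, coeff_monomial, if_pos rfl, hs, ht]
    simp only [smul_eq_mul]
    linear_combination (-(t * coeffModulus n)) * huv

theorem ContainsBelow.succ_of_even_coeff {G : AddSubgroup ℤ[X]} {n : ℕ}
    (hGM : G ≤ admissible) (h : ContainsBelow G n) (hn : Odd n)
    (hmem : monomial n (2 * coeffModulus n) ∈ G)
    (heven : ∀ q ∈ admissible, (∀ m ≥ n + 1, q.coeff m = 0) → (q.coeff n : ZMod 2) = 0) :
    ContainsBelow G (n + 1) := by
  refine h.succ_of_forall_exists hGM fun q hq hqn => ?_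
  have h2 := heven q hq hqn
  obtain ⟨t, ht⟩ := hq.1 n
  have h3 : Even (q.coeff n) :=
    even_iff_two_dvd.2 ((ZMod.intCast_zmod_eq_zero_iff_dvd _ 2).1 h2)
  obtain ⟨s, hs⟩ : Even t := by
    rw [ht, Int.even_mul] at h3
    exact h3.resolve_left (Int.not_even_iff_odd.2 (odd_coeffModulus hn))
  refine ⟨s • monomial n (2 * coeffModulus n), zsmul_mem hmem _, fun m hm => ?_, ?_⟩
  · rw [coeff_smul, coeff_monomial_eq_zero_of_lt _ m hm, smul_zero]
  · rw [coeff_smul, coeff_monomial, if_pos rfl, ht, hs, smul_eq_mul]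
    ring

theorem ContainsBelow.succ_of_even {G : AddSubgroup ℤ[X]} {n : ℕ}
    (h : ContainsBelow G n) (hn : Even n) : ContainsBelow G (n + 1) := by
  intro q hq hqn
  refine h q hq fun m hm => ?_
  rcases hm.eq_or_lt with rfl | hm
  · simpa [coeffModulus_of_even hn] using hq.1 n
  · exact hqn m hm

/-- An admissible polynomial with leading monomial `coeffModulus j * X ^ j`, for `j ≠ 1, 5, 11`. -/
noncomputable def admissibleRep (j : ℕ) : ℤ[X] :=
  monomial j (coeffModulus j) + (if indicatorEight j = 1 then monomial 5 3 else 0) +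
    if indicatorTwentyFour j = 1 then monomial 11 3 else 0

theorem coeffModulus_five : coeffModulus 5 = 3 := by
  norm_num [coeffModulus, digitSum, show Odd 5 by decide]

theorem coeffModulus_eleven : coeffModulus 11 = 3 := by
  norm_num [coeffModulus, digitSum, show Odd 11 by decide]

/-- The terms `3 * X ^ 5` and `3 * X ^ 11` have parities `(1, 0)` and `(0, 1)`, so they correct the
two conditions independently. -/
theorem admissibleRep_mem {j : ℕ} (hj : Odd j) : admissibleRep j ∈ admissible := by
  have h5 : indicatorEight 5 = 1 ∧ indicatorTwentyFour 5 = 0 := by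
    rw [indicatorEight_eq, indicatorTwentyFour_eq]; decide
  have h11 : indicatorEight 11 = 0 ∧ indicatorTwentyFour 11 = 1 := by
    rw [indicatorEight_eq, indicatorTwentyFour_eq]; decide
  have h01 : ∀ a : ZMod 2, a = 0 ∨ a = 1 := by decide
  have hj1 : (coeffModulus j : ZMod 2) = 1 := by
    rcases h01 (coeffModulus j : ZMod 2) with h | h
    · exact absurd ((ZMod.intCast_zmod_eq_zero_iff_dvd _ 2).1 h)
        (Int.two_dvd_ne_zero.2 (Int.odd_iff.1 (odd_coeffModulus hj)))
    · exact h
  have h3 : (3 : ZMod 2) = 1 := by decide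
  rw [mem_admissible]
  refine ⟨add_mem (add_mem (monomial_mem_divisibleCoeffs dvd_rfl) ?_) ?_, ?_, ?_⟩
  · split_ifs
    · exact monomial_mem_divisibleCoeffs (by rw [coeffModulus_five])
    · exact zero_mem _
  · split_ifs
    · exact monomial_mem_divisibleCoeffs (by rw [coeffModulus_eleven])
    · exact zero_mem _
  all_goals
    rcases h01 (indicatorEight j) with h | h <;> rcases h01 (indicatorTwentyFour j) with h' | h' <;>
    simp [admissibleRep, h, h', parity_monomial, h5, h11, hj1, h3, CharTwo.add_self_eq_zero]

theorem indicatorEight_ne_one_of_lt {j : ℕ} (hj : j < 5) : indicatorEight j ≠ 1 := by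
  rw [indicatorEight_eq, if_neg (by omega)]
  decide

theorem indicatorTwentyFour_ne_one_of_lt {j : ℕ} (hj : j < 11) : indicatorTwentyFour j ≠ 1 := by
  rw [indicatorTwentyFour_eq, if_neg (by omega)]
  decide

theorem coeff_admissibleRep_of_lt {j m : ℕ} (hm : j < m) : (admissibleRep j).coeff m = 0 := by
  simp only [admissibleRep, coeff_add]
  rw [coeff_monomial, if_neg hm.ne]
  have h1 := @indicatorEight_ne_one_of_lt j
  have h2 := @indicatorTwentyFour_ne_one_of_lt j
  split_ifs with h h' h' <;> simp only [coeff_monomial, coeff_zero, zero_add, add_zero]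
  · rw [if_neg, if_neg, add_zero]
    · rintro rfl; exact h2 hm h'
    · rintro rfl; exact h1 hm h
  · rw [if_neg]
    rintro rfl; exact h1 hm h
  · rw [if_neg]
    rintro rfl; exact h2 hm h'

theorem coeff_admissibleRep_self {j : ℕ} (h5 : j ≠ 5) (h11 : j ≠ 11) :
    (admissibleRep j).coeff j = coeffModulus j := by
  simp only [admissibleRep, coeff_add]
  rw [coeff_monomial, if_pos rfl]
  split_ifs <;> simp [coeff_monomial, h5.symm, h11.symm]

theorem ContainsBelow.admissibleRep_mem {G : AddSubgroup ℤ[X]} {n j : ℕ} (h : ContainsBelow G n)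
    (hjn : j < n) (hj : Odd j) : admissibleRep j ∈ G :=
  h _ (_root_.admissibleRep_mem hj) fun _ hm => coeff_admissibleRep_of_lt (hjn.trans_le hm)

theorem ContainsBelow.succ_of_cubic {G : AddSubgroup ℤ[X]} {a j : ℕ} (hX : X ∈ G)
    (hG : ∀ f ∈ G, f ^ 3 ∈ G) (hGM : G ≤ admissible) (h : ContainsBelow G (a + 2 * j))
    (ha : X ^ a ∈ G) (ha' : Odd a) (hj : Odd j) (haj : a < j) (h5 : j ≠ 5) (h11 : j ≠ 11) :
    ContainsBelow G (a + 2 * j + 1) := by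
  set g := admissibleRep j with hg
  have hgG : g ∈ G := h.admissibleRep_mem (by omega) hj
  have hdeg : g.natDegree ≤ j :=
    natDegree_le_iff_coeff_eq_zero.2 fun m hm => coeff_admissibleRep_of_lt hm
  have hdeg2 : (g ^ 2).natDegree ≤ 2 * j := natDegree_pow_le_of_le 2 hdeg
  -- The factor `X ^ a` is cancelled. Since `a < j`, the square `g ^ 2` then dominates `X ^ a * g`.
  have hcoeff (m : ℕ) : (3 * ((X ^ a) ^ 2 * g + X ^ a * g ^ 2)).coeff (m + (a + j)) =
      3 * ((X ^ a * g).coeff (m + j) + (g ^ 2).coeff (m + j)) := by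
    rw [show 3 * ((X ^ a) ^ 2 * g + X ^ a * g ^ 2) = C 3 * ((X ^ a * g + g ^ 2) * X ^ a) by
      simp only [map_ofNat]; ring, coeff_C_mul, show m + (a + j) = m + j + a by ring,
      coeff_mul_X_pow, coeff_add]
  have hlow (m : ℕ) (hm : j ≤ m) : (X ^ a * g).coeff (m + j) = 0 := by
    refine coeff_eq_zero_of_natDegree_lt (natDegree_mul_le.trans_lt ?_)
    rw [natDegree_X_pow]
    omega
  refine h.succ_of_odd_coeff hX hG hGM (ha'.add_even (even_two_mul j)) (cubic_mem hG ha hgG)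
    (fun m hm => ?_) ?_
  · obtain ⟨m, rfl⟩ : ∃ k, m = k + (a + j) := ⟨m - (a + j), by omega⟩
    rw [hcoeff, hlow m (by omega), coeff_eq_zero_of_natDegree_lt (by omega : _ < m + j)]
    simp
  · rw [show a + 2 * j = j + (a + j) by ring, hcoeff, hlow j le_rfl, show j + j = 2 * j by ring,
      coeff_pow_of_natDegree_le hdeg, hg, coeff_admissibleRep_self h5 h11, zero_add]
    exact Odd.mul (by decide) (odd_coeffModulus hj).pow

/-! ### The exceptional degrees -/

theorem admissibleRep_eq {j : ℕ} (hj : Odd j) (a b : Prop) [Decidable a] [Decidable b]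
    (ha : (j % 8 = 5 ∨ j % 8 = 7) ↔ a)
    (hb : ((j % 24 = 1 ∨ j % 24 = 11 ∨ j % 24 = 15 ∨ j % 24 = 17 ∨ j % 24 = 19 ∨ j % 24 = 21) ∧
      j ≠ 1) ↔ b) :
    admissibleRep j = 3 ^ ((digitSum 3 j - 1) / 2) * X ^ j + (if a then 3 * X ^ 5 else 0) +
      if b then 3 * X ^ 11 else 0 := by
  have h1 : indicatorEight j = 1 ↔ a := by
    simp only [indicatorEight_eq, ha]; simp
  have h2 : indicatorTwentyFour j = 1 ↔ b := by
    simp only [indicatorTwentyFour_eq, hb]; simp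
  rw [admissibleRep, coeffModulus_of_odd hj]
  simp only [h1, h2, ← C_mul_X_pow_eq_monomial, map_ofNat, map_pow]

theorem admissibleRep_seven : admissibleRep 7 = 3 * X ^ 7 + 3 * X ^ 5 := by
  rw [admissibleRep_eq (by decide) True False (by simp) (by simp)]
  norm_num [digitSum]

theorem admissibleRep_thirteen : admissibleRep 13 = 3 * X ^ 13 + 3 * X ^ 5 := by
  rw [admissibleRep_eq (by decide) True False (by simp) (by simp)]
  norm_num [digitSum]

theorem admissibleRep_fifteen : admissibleRep 15 = 3 * X ^ 15 + 3 * X ^ 5 + 3 * X ^ 11 := by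
  rw [admissibleRep_eq (by decide) True True (by simp) (by simp)]
  norm_num [digitSum]

theorem admissibleRep_seventeen : admissibleRep 17 = 9 * X ^ 17 + 3 * X ^ 11 := by
  rw [admissibleRep_eq (by decide) False True (by simp) (by simp)]
  norm_num [digitSum]

theorem X_pow_three_nine_twentySeven_mem {G : AddSubgroup ℤ[X]} (hX : X ∈ G)
    (hG : ∀ f ∈ G, f ^ 3 ∈ G) : X ^ 3 ∈ G ∧ X ^ 9 ∈ G ∧ X ^ 27 ∈ G :=
  ⟨X_pow_three_pow_mem hX hG 1, X_pow_three_pow_mem hX hG 2, X_pow_three_pow_mem hX hG 3⟩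

theorem eighteen_mul_X_pow_thirtyFive_mem {G : AddSubgroup ℤ[X]} (hX : X ∈ G)
    (hG : ∀ f ∈ G, f ^ 3 ∈ G) : 18 * X ^ 35 ∈ G := by
  obtain ⟨h3, -, h27⟩ := X_pow_three_nine_twentySeven_mem hX hG
  have := sub_mem (six_mul_mem hG h27 hX (cubic_mem hG hX h3))
    (zsmul_mem (six_mul_mem hG h27 h3 h3) 3)
  convert this using 1
  simp only [zsmul_eq_mul]; push_cast; ring

/-- Here `13 = 3 + 2 * 5` meets the exceptional `j = 5`; an odd leading coefficient is obtained by
cancelling terms of degree up to 37. -/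
theorem degree_thirteen_mem {G : AddSubgroup ℤ[X]} (hX : X ∈ G)
    (hG : ∀ f ∈ G, f ^ 3 ∈ G) :
    9 * X ^ 13 + 6 * X ^ 11 + 3 * X ^ 5 ∈ G := by
  obtain ⟨h3, h9, h27⟩ := X_pow_three_nine_twentySeven_mem hX hG
  have b7 : 3 * X ^ 7 + 3 * X ^ 5 ∈ G := by
    convert cubic_mem hG hX h3 using 1; ring
  have d5 := six_mul_mem hG hX hX h3
  have d11 := six_mul_mem hG hX hX h9
  have d13 := six_mul_mem hG hX h3 h9
  have d15 := six_mul_mem hG h3 h3 h9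
  have d19 := six_mul_mem hG hX h9 h9
  have d21 := six_mul_mem hG h3 h9 h9
  have d29 := six_mul_mem hG hX hX h27
  have d31 := six_mul_mem hG hX h3 h27
  have d33 := six_mul_mem hG h3 h3 h27
  have d37 := six_mul_mem hG hX h9 h27
  have d35 := eighteen_mul_X_pow_thirtyFive_mem hX hG
  have d17 : 18 * X ^ 17 ∈ G := by
    convert sub_mem (six_mul_mem hG hX b7 h9) (zsmul_mem d15 3) using 1
    simp only [zsmul_eq_mul]; push_cast; ring
  have b15 : 3 * X ^ 15 + 3 * X ^ 5 + 3 * X ^ 11 ∈ G := by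
    have := sub_mem (sub_mem (sub_mem (sub_mem (sub_mem (cubic_mem hG hX b7) (zsmul_mem d15 4))
      (zsmul_mem d13 9)) (zsmul_mem d11 4)) (zsmul_mem h9 9)) (zsmul_mem b7 3)
    convert add_mem this (zsmul_mem d5 2) using 1
    simp only [zsmul_eq_mul]; push_cast; ring
  have b17 : 9 * X ^ 17 + 3 * X ^ 11 ∈ G := by
    convert sub_mem (sub_mem (sub_mem (sub_mem (cubic_mem hG h3 b7) d17) (zsmul_mem d15 9))
      (zsmul_mem d13 6)) d11 using 1
    simp only [zsmul_eq_mul]; push_cast; ring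
  have d23 : 18 * X ^ 23 ∈ G := by
    convert sub_mem (sub_mem (six_mul_mem hG h3 h3 b17) d17) (six_mul_mem hG h9 h9 d5) using 1
    ring
  have d25 := six_mul_mem hG h9 h9 b7
  -- Modulo 2 these seven summands add up to `X ^ 27 + X ^ 13 + X ^ 5`; `heven` removes `X ^ 27` and
  -- the even remainder above degree 13.
  have hodd : 3 * ((9 * X ^ 17 + 3 * X ^ 11) ^ 2 * X ^ 3 +
        (9 * X ^ 17 + 3 * X ^ 11) * (X ^ 3) ^ 2) +
      3 * ((3 * X ^ 15 + 3 * X ^ 5 + 3 * X ^ 11) ^ 2 * (3 * X ^ 7 + 3 * X ^ 5) +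
        (3 * X ^ 15 + 3 * X ^ 5 + 3 * X ^ 11) * (3 * X ^ 7 + 3 * X ^ 5) ^ 2) +
      3 * ((9 * X ^ 17 + 3 * X ^ 11) ^ 2 * X + (9 * X ^ 17 + 3 * X ^ 11) * X ^ 2) +
      3 * ((X ^ 9) ^ 2 * (3 * X ^ 7 + 3 * X ^ 5) + X ^ 9 * (3 * X ^ 7 + 3 * X ^ 5) ^ 2) +
      3 * ((X ^ 3) ^ 2 * X ^ 9 + X ^ 3 * (X ^ 9) ^ 2) +
      3 * (X ^ 2 * X ^ 9 + X * (X ^ 9) ^ 2) + (3 * X ^ 15 + 3 * X ^ 5 + 3 * X ^ 11) ∈ G :=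
    add_mem (add_mem (add_mem (add_mem (add_mem (add_mem (cubic_mem hG b17 h3)
      (cubic_mem hG b15 b7)) (cubic_mem hG b17 hX)) (cubic_mem hG h9 b7)) (cubic_mem hG h3 h9))
      (cubic_mem hG hX h9)) b15
  have heven := add_mem (add_mem (add_mem (add_mem (add_mem (add_mem (add_mem (add_mem (add_mem
    (add_mem (add_mem (zsmul_mem d37 54) (zsmul_mem d35 18)) (zsmul_mem d33 27))
    (zsmul_mem d31 54)) (zsmul_mem d29 54)) (zsmul_mem h27 405)) (zsmul_mem d25 20)) (zsmul_mem d23 3))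
    (zsmul_mem d21 50)) (zsmul_mem d19 23)) (zsmul_mem d17 14)) (zsmul_mem d15 28)
  convert sub_mem hodd heven using 1
  simp only [zsmul_eq_mul]; push_cast; ring

theorem ContainsBelow.succ_thirteen {G : AddSubgroup ℤ[X]} (hX : X ∈ G)
    (hG : ∀ f ∈ G, f ^ 3 ∈ G) (hGM : G ≤ admissible) (h : ContainsBelow G 13) :
    ContainsBelow G 14 := by
  refine h.succ_of_odd_coeff hX hG hGM (by decide) (degree_thirteen_mem hX hG)
    (fun m hm => ?_) ?_
  · refine coeff_eq_zero_of_natDegree_lt (lt_of_le_of_lt ?_ hm)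
    compute_degree
  · rw [show (9 * X ^ 13 + 6 * X ^ 11 + 3 * X ^ 5 : ℤ[X]).coeff 13 = 9 by compute_degree!]
    decide

theorem ContainsBelow.succ_twentyThree {G : AddSubgroup ℤ[X]} (hX : X ∈ G)
    (hG : ∀ f ∈ G, f ^ 3 ∈ G) (hGM : G ≤ admissible) (h : ContainsBelow G 23) :
    ContainsBelow G 24 := by
  obtain ⟨h3, h9, h27⟩ := X_pow_three_nine_twentySeven_mem hX hG
  have b13 := h.admissibleRep_mem (j := 13) (by norm_num) (by decide)
  have b15 := h.admissibleRep_mem (j := 15) (by norm_num) (by decide)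
  have b17 := h.admissibleRep_mem (j := 17) (by norm_num) (by decide)
  rw [admissibleRep_thirteen] at b13
  rw [admissibleRep_fifteen] at b15
  rw [admissibleRep_seventeen] at b17
  have hodd := add_mem (add_mem (cubic_mem hG b17 hX) (cubic_mem hG b13 h9)) (cubic_mem hG b15 hX)
  have heven := add_mem (add_mem (add_mem
    (zsmul_mem (eighteen_mul_X_pow_thirtyFive_mem hX hG) 15)
    (zsmul_mem (six_mul_mem hG hX h3 h27) 6)) (zsmul_mem (six_mul_mem hG hX hX h27) 27))
    (zsmul_mem h27 108)
  have hp : 63 * X ^ 23 + 54 * X ^ 21 + 54 * X ^ 19 + 63 * X ^ 17 + 18 * X ^ 13 + 27 * X ^ 11 +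
      9 * X ^ 7 ∈ G := by
    convert sub_mem hodd heven using 1
    simp only [zsmul_eq_mul]; push_cast; ring
  refine h.succ_of_odd_coeff hX hG hGM (by decide) hp (fun m hm => ?_) ?_
  · refine coeff_eq_zero_of_natDegree_lt (lt_of_le_of_lt ?_ hm)
    compute_degree
  · rw [show (63 * X ^ 23 + 54 * X ^ 21 + 54 * X ^ 19 + 63 * X ^ 17 + 18 * X ^ 13 + 27 * X ^ 11 +
      9 * X ^ 7 : ℤ[X]).coeff 23 = 63 by compute_degree!]
    decide

theorem ContainsBelow.succ_twentyFive {G : AddSubgroup ℤ[X]} (hX : X ∈ G)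
    (hG : ∀ f ∈ G, f ^ 3 ∈ G) (hGM : G ≤ admissible) (h : ContainsBelow G 25) :
    ContainsBelow G 26 := by
  obtain ⟨-, h9, -⟩ := X_pow_three_nine_twentySeven_mem hX hG
  have b7 := h.admissibleRep_mem (j := 7) (by norm_num) (by decide)
  rw [admissibleRep_seven] at b7
  -- With `X ^ 9` and degree 7 the other term leads: `2 * 9 + 7 = 25`.
  have hp : 9 * X ^ 25 + 36 * X ^ 23 + 54 * X ^ 21 + 27 * X ^ 19 ∈ G := by
    convert cubic_mem hG h9 b7 using 1
    ring
  refine h.succ_of_odd_coeff hX hG hGM (by decide) hp (fun m hm => ?_) ?_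
  · refine coeff_eq_zero_of_natDegree_lt (lt_of_le_of_lt ?_ hm)
    compute_degree
  · rw [show (9 * X ^ 25 + 36 * X ^ 23 + 54 * X ^ 21 + 27 * X ^ 19 : ℤ[X]).coeff 25 = 9 by
      compute_degree!]
    decide

theorem ContainsBelow.succ_five {G : AddSubgroup ℤ[X]} (hX : X ∈ G)
    (hG : ∀ f ∈ G, f ^ 3 ∈ G) (hGM : G ≤ admissible) (h : ContainsBelow G 5) :
    ContainsBelow G 6 := by
  obtain ⟨h3, -, -⟩ := X_pow_three_nine_twentySeven_mem hX hG
  refine h.succ_of_even_coeff hGM (by decide) ?_ fun q hq hqn => ?_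
  · rw [coeffModulus_five, ← C_mul_X_pow_eq_monomial]
    convert six_mul_mem hG hX hX h3 using 1
    norm_num; ring
  · have := (mem_admissible.1 hq).2.1
    rw [parity_eq_sum_range _ hqn] at this
    simpa [Finset.sum_range_succ, indicatorEight_eq] using this

theorem ContainsBelow.succ_eleven {G : AddSubgroup ℤ[X]} (hX : X ∈ G)
    (hG : ∀ f ∈ G, f ^ 3 ∈ G) (hGM : G ≤ admissible) (h : ContainsBelow G 11) :
    ContainsBelow G 12 := by
  obtain ⟨-, h9, -⟩ := X_pow_three_nine_twentySeven_mem hX hG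
  refine h.succ_of_even_coeff hGM (by decide) ?_ fun q hq hqn => ?_
  · rw [coeffModulus_eleven, ← C_mul_X_pow_eq_monomial]
    convert six_mul_mem hG hX hX h9 using 1
    norm_num; ring
  · have := (mem_admissible.1 hq).2.2
    rw [parity_eq_sum_range _ hqn] at this
    simpa [Finset.sum_range_succ, indicatorTwentyFour_eq] using this

theorem ContainsBelow.succ_of_X_pow_mem {G : AddSubgroup ℤ[X]} {n : ℕ} (hX : X ∈ G)
    (hG : ∀ f ∈ G, f ^ 3 ∈ G) (hGM : G ≤ admissible) (h : ContainsBelow G n) (hn : Odd n)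
    (hXn : X ^ n ∈ G) : ContainsBelow G (n + 1) :=
  h.succ_of_odd_coeff hX hG hGM hn hXn
    (fun m hm => by rw [coeff_X_pow, if_neg (by omega)]) (by simp)

theorem containsBelow {G : AddSubgroup ℤ[X]} (hX : X ∈ G) (hG : ∀ f ∈ G, f ^ 3 ∈ G)
    (hGM : G ≤ admissible) (n : ℕ) : ContainsBelow G n := by
  obtain ⟨h3, h9, -⟩ := X_pow_three_nine_twentySeven_mem hX hG
  induction n with
  | zero =>
    intro q _ h
    rw [show q = 0 from Polynomial.ext fun m => by simpa using h m (Nat.zero_le m)]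
    exact zero_mem G
  | succ n ih =>
    rcases Nat.even_or_odd n with hn | hn
    · exact ih.succ_of_even hn
    by_cases h1 : n = 1
    · subst h1; exact ih.succ_of_X_pow_mem hX hG hGM hn (by simpa using hX)
    by_cases h3' : n = 3
    · subst h3'; exact ih.succ_of_X_pow_mem hX hG hGM hn h3
    by_cases h5 : n = 5
    · subst h5; exact ih.succ_five hX hG hGM
    by_cases h9' : n = 9
    · subst h9'; exact ih.succ_of_X_pow_mem hX hG hGM hn h9
    by_cases h11 : n = 11
    · subst h11; exact ih.succ_eleven hX hG hGM
    by_cases h13 : n = 13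
    · subst h13; exact ih.succ_thirteen hX hG hGM
    by_cases h23 : n = 23
    · subst h23; exact ih.succ_twentyThree hX hG hGM
    by_cases h25 : n = 25
    · subst h25; exact ih.succ_twentyFive hX hG hGM
    rw [Nat.odd_iff] at hn
    -- The residue modulo 4 decides whether `a = 3` or `a = 1` makes `j` odd. The degrees treated
    -- above are those with `j ≤ a` or `j ∈ {5, 11}`.
    have h4 : n % 4 = 1 ∨ n % 4 = 3 := by omega
    rcases h4 with h4 | h4
    · obtain ⟨j, rfl⟩ : ∃ j, n = 3 + 2 * j := ⟨(n - 3) / 2, by omega⟩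
      exact ih.succ_of_cubic hX hG hGM h3 (by decide) (Nat.odd_iff.2 (by omega)) (by omega)
        (by omega) (by omega)
    · obtain ⟨j, rfl⟩ : ∃ j, n = 1 + 2 * j := ⟨(n - 1) / 2, by omega⟩
      exact ih.succ_of_cubic hX hG hGM (by simpa using hX) (by decide) (Nat.odd_iff.2 (by omega))
        (by omega) (by omega) (by omega)

/-! ### The generated subnearring -/

theorem PolySubnearring.closure_eq_admissible :
    (closure {X, X ^ 3}).toAddSubgroup = admissible := by
  have hX : X ∈ (closure {X, X ^ 3}).toAddSubgroup := fun S hS => hS (by simp)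
  have hle := closure_le X_mem_admissible fun _ => pow_three_mem_admissible
  refine le_antisymm hle fun q hq => ?_
  exact containsBelow hX (fun _ => pow_three_mem_closure) hle (q.natDegree + 1) q hq
    fun m hm => coeff_eq_zero_of_natDegree_lt hm

theorem mem_divisibleCoeffs_iff {p : ℤ[X]} : p ∈ divisibleCoeffs ↔
    (∀ i : ℕ, i ∉ eqClass 2 {1} → p.coeff i = 0) ∧
      ∀ i : ℕ, i ∈ eqClass 2 {1} → (3 : ℤ) ^ ((digitSum 3 i - 1) / 2) ∣ p.coeff i := by
  have hodd (i : ℕ) : i ∈ eqClass 2 {1} ↔ Odd i := by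
    simp [eqClass, Nat.ModEq, Nat.odd_iff]
  simp only [hodd]
  rw [← forall_and]
  refine forall_congr' fun i => ?_
  by_cases hi : Odd i <;> simp [coeffModulus, hi]

theorem theorem5p14 (p : ℤ[X]) :
    p ∈ (PolySubnearring.closure {X, X ^ 3}).carrier ↔
      (∀ i : ℕ, i ∉ eqClass 2 {1} → p.coeff i = 0) ∧
      (∀ i : ℕ, i ∈ eqClass 2 {1} → (3 : ℤ) ^ ((digitSum 3 i - 1) / 2) ∣ p.coeff i) ∧
      (2 : ℤ) ∣ ∑ j ∈ p.support with j ∈ eqClass 8 {5, 7}, p.coeff j ∧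
      (2 : ℤ) ∣ ∑ j ∈ p.support with j ∈ eqClass 24 {1, 11, 15, 17, 19, 21} ∧ j ≠ 1,
        p.coeff j := by
  rw [two_dvd_sum_filter_iff, two_dvd_sum_filter_iff, ← and_assoc, ← mem_divisibleCoeffs_iff]
  change p ∈ (PolySubnearring.closure {X, X ^ 3}).toAddSubgroup ↔ _
  rw [PolySubnearring.closure_eq_admissible]
  exact mem_admissible
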